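/- Proposition 3.2 (extension of piecewise smooth forms from the boundary of a simplex). Let $\Delta$ be any (closed, geometric) simplex of dimension $k\ge 0$, that is, the convex hull of $k+1$ affinely independent points of a real normed space, regarded as a smooth manifold with corners. Let $\mathcal A$ be a transitive Lie algebroid on $\Delta$: a smooth real vector bundle of finite rank $\mathcal A\to\Delta$ with a fibrewise surjective smooth bundle morphism $\gamma:\mathcal A\to T\Delta$ (the anchor) and a real Lie bracket on its smooth sections such that $\gamma$ induces a Lie algebra homomorphism into the vector fields on $\Delta$ and $[\xi,f\eta]=f[\xi,\eta]+(\gamma(\xi)\cdot f)\,\eta$ for all smooth sections $\xi,\eta$ and all $f\in C^\infty(\Delta)$. For a face $\alpha$ of $\Delta$ (including $\alpha=\Delta$), let $\mathcal A^{!!}_\alpha$ be the restriction of $\mathcal A$ to $\alpha$, i.e. the inverse image of $\mathcal A$ under the inclusion $\alpha\hookrightarrow\Delta$; its fibre at $x\in\alpha$ is $(\mathcal A^{!!}_\alpha)_x=\{a\in\mathcal A_x:\gamma(a)\in T_x\alpha\}$. For a set $K$ of faces of $\Delta$ that forms a simplicial complex, a piecewise smooth form of degree $p\ge 0$ on $\{\mathcal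 A^{!!}_\alpha\}_{\alpha\in K}$ is a family $(\omega_\alpha)_{\alpha\in K}$, where each $\omega_\alpha$ is a smooth form of degree $p$ on $\mathcal A^{!!}_\alpha$, such that whenever $\beta,\alpha\in K$ and $\beta$ is a face of $\alpha$, $$\omega_\beta(x)(u_1,\dots,u_p)=\omega_\alpha(x)(u_1,\dots,u_p)\qquad\text{for all }x\in\beta,\ u_1,\dots,u_p\in(\mathcal A^{!!}_\beta)_x .$$ Let $\underline{\mathcal A^{\Delta}}$ be the family of the $\mathcal A^{!!}_\alpha$ over all faces $\alpha$ of $\Delta$, and $\underline{\mathcal A^{\mathbf{bd}\,\Delta}}$ the family over all proper faces. Then, for every $p\ge 0$ and every piecewise smooth form $\xi=(\xi_\alpha)$ of degree $p$ on $\underline{\mathcal A^{\mathbf{bd}\,\Delta}}$, there is a piecewise smooth form $\omega=(\omega_\alpha)$ of degree $p$ on $\underline{\mathcal A^{\Delta}}$ whose restriction to the boundary is $\xi$: $\omega_{/\mathbf{bd}\,\Delta}=\xi$, that is, $\omega_\alpha=\xi_\alpha$ for every proper face $\alpha$ of $\Delta$. -/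

import Mathlib

open scoped Manifold ContDiff
open Bundle (TotalSpace)

noncomputable section

/-! ### A geometric simplex as a smooth manifold with corners

A `k`-simplex `s : Affine.Simplex ℝ E k` is given by `k + 1` affinely independent vertices; as a
space it is the closed simplex `s.closedInterior`, the convex hull of the vertices. -/

namespace Affine.Simplex

variable {E : Type*} [NormedAddCommGroup E] [NormedSpace ℝ E] {k : ℕ}

/-- The linear span of all differences of points of the simplex. -/
abbrev dir (s : Affine.Simplex ℝ E k) : Submodule ℝ E := vectorSpan ℝ (Set.range s.points)

/-- The closed simplex, as a topological space. -/
abbrev Pt (s : Affine.Simplex ℝ E k) : Type _ := s.closedInterior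

theorem sub_mem_dir (s : Affine.Simplex ℝ E k) {x : E} (hx : x ∈ s.closedInterior) :
    x - s.points 0 ∈ s.dir := by
  have h := AffineSubspace.vsub_mem_direction (closedInterior_subset_affineSpan hx)
    (mem_affineSpan ℝ (Set.mem_range_self (f := s.points) 0))
  rwa [direction_affineSpan] at h

theorem affineIndependent_translate (s : Affine.Simplex ℝ E k) :
    AffineIndependent ℝ (fun i => (⟨s.points i - s.points 0,
      s.sub_mem_dir (s.point_mem_closedInterior i)⟩ : s.dir)) := by
  let f : s.dir →ᵃ[ℝ] E := s.dir.subtype.toAffineMap + AffineMap.const ℝ _ (s.points 0)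
  refine AffineIndependent.of_comp f ?_
  have hf : (f ∘ fun i => (⟨s.points i - s.points 0,
      s.sub_mem_dir (s.point_mem_closedInterior i)⟩ : s.dir)) = s.points := by
    funext i
    simp [f]
  rw [hf]
  exact s.independent

/-- The vertices, translated so that the first one is the origin, as an affine basis of `s.dir`. -/
def dirBasis (s : Affine.Simplex ℝ E k) : AffineBasis (Fin (k + 1)) ℝ s.dir where
  toFun i := ⟨s.points i - s.points 0, s.sub_mem_dir (s.point_mem_closedInterior i)⟩
  ind' := s.affineIndependent_translate
  tot' := by
    rw [s.affineIndependent_translate.affineSpan_eq_top_iff_card_eq_finrank_add_one,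
      s.independent.finrank_vectorSpan (Fintype.card_fin _)]
    simp

theorem dirBasis_apply (s : Affine.Simplex ℝ E k) (i : Fin (k + 1)) :
    ((s.dirBasis i : s.dir) : E) = s.points i - s.points 0 := rfl

/-- The barycentric coordinates with respect to the vertices of the point `v + s.points 0`. -/
abbrev bary (s : Affine.Simplex ℝ E k) (i : Fin (k + 1)) (v : s.dir) : ℝ := s.dirBasis.coord i v

theorem sum_bary_smul (s : Affine.Simplex ℝ E k) (v : s.dir) :
    ∑ i, s.bary i v • s.points i = (v : E) + s.points 0 := by
  have h := congrArg (Subtype.val) (s.dirBasis.linear_combination_coord_eq_self v)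
  have h1 := s.dirBasis.sum_coord_apply_eq_one v
  simp only [AddSubmonoidClass.coe_finsetSum, Submodule.coe_smul, dirBasis_apply, smul_sub,
    Finset.sum_sub_distrib, ← Finset.sum_smul, h1, one_smul] at h
  rw [← h, sub_add_cancel]

theorem sum_smul_mem (s : Affine.Simplex ℝ E k) {w : Fin (k + 1) → ℝ} (h0 : ∀ i, 0 ≤ w i)
    (h1 : ∑ i, w i = 1) : ∑ i, w i • s.points i ∈ s.closedInterior := by
  rw [← convexHull_eq_closedInterior]
  exact (convex_convexHull ℝ _).sum_mem (fun i _ => h0 i) h1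
    (fun i _ => subset_convexHull ℝ _ (Set.mem_range_self i))

theorem mem_iff_bary (s : Affine.Simplex ℝ E k) (v : s.dir) :
    (v : E) + s.points 0 ∈ s.closedInterior ↔ ∀ i, 0 ≤ s.bary i v := by
  have h1 := s.dirBasis.sum_coord_apply_eq_one v
  have h := affineCombination_mem_closedInterior_iff (s := s) h1
  rw [Finset.affineCombination_eq_linear_combination _ _ _ h1] at h
  have h2 := s.sum_bary_smul v
  refine ⟨fun hv i => ?_, fun hv => ?_⟩
  · rw [← h2] at hv
    exact (h.1 hv i).1
  · rw [← h2]
    exact s.sum_smul_mem hv h1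

/-- The sum of the positive parts of the barycentric coordinates. -/
abbrev posSum (s : Affine.Simplex ℝ E k) (v : s.dir) : ℝ := ∑ i, max (s.bary i v) 0

theorem posSum_pos (s : Affine.Simplex ℝ E k) (v : s.dir) : 0 < s.posSum v := by
  have h1 := s.dirBasis.sum_coord_apply_eq_one v
  have h2 : ∑ i, s.bary i v ≤ s.posSum v := Finset.sum_le_sum fun i _ => le_max_left _ _
  linarith

/-- A continuous map from `s.dir` onto the simplex, inverse to `x ↦ x - s.points 0`: replace the
barycentric coordinates by their positive parts and normalise. -/
def retr (s : Affine.Simplex ℝ E k) (v : s.dir) : s.Pt :=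
  ⟨∑ i, (max (s.bary i v) 0 / s.posSum v) • s.points i, s.sum_smul_mem
    (fun i => div_nonneg (le_max_right _ _) (s.posSum_pos v).le)
    (by rw [← Finset.sum_div]; exact div_self (s.posSum_pos v).ne')⟩

theorem continuous_retr (s : Affine.Simplex ℝ E k) : Continuous s.retr := by
  have hb : ∀ i, Continuous (fun v => s.bary i v) := fun i => continuous_barycentric_coord _ i
  refine Continuous.subtype_mk ?_ _
  refine continuous_finsetSum _ fun i _ => Continuous.smul (Continuous.div ?_ ?_ ?_)
    continuous_const
  · exact (hb i).max continuous_const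
  · exact continuous_finsetSum _ fun j _ => (hb j).max continuous_const
  · exact fun v => (s.posSum_pos v).ne'

theorem retr_eq (s : Affine.Simplex ℝ E k) (v : s.dir)
    (hv : (v : E) + s.points 0 ∈ s.closedInterior) : (s.retr v : E) = (v : E) + s.points 0 := by
  have hv' := (s.mem_iff_bary v).1 hv
  have hm : ∀ i, max (s.bary i v) 0 = s.bary i v := fun i => max_eq_left (hv' i)
  have h1 : s.posSum v = 1 := by
    simp only [posSum, hm]; exact s.dirBasis.sum_coord_apply_eq_one v
  simp only [retr, hm, h1, div_one]
  exact s.sum_bary_smul v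

/-- The chart `x ↦ x - s.points 0`, identifying the simplex with a full-dimensional convex body in
the finite-dimensional space `s.dir`. -/
def chart (s : Affine.Simplex ℝ E k) (x : s.Pt) : s.dir :=
  ⟨(x : E) - s.points 0, s.sub_mem_dir x.2⟩

theorem range_chart (s : Affine.Simplex ℝ E k) :
    Set.range s.chart = {v : s.dir | (v : E) + s.points 0 ∈ s.closedInterior} := by
  ext v
  refine ⟨?_, fun hv => ⟨⟨_, hv⟩, ?_⟩⟩
  · rintro ⟨x, rfl⟩
    simp [chart]
  · ext
    simp [chart]

/-- The smooth structure on a closed simplex: a manifold with corners, modelled on itself through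
the global chart `x ↦ x - s.points 0`.  A function on the simplex is smooth if and only if it is
smooth (`ContDiffOn`) in this chart, and the tangent space at every point is `s.dir`. -/
def model (s : Affine.Simplex ℝ E k) : ModelWithCorners ℝ s.dir s.Pt where
  toFun := s.chart
  invFun := s.retr
  source := Set.univ
  target := Set.range s.chart
  map_source' x _ := Set.mem_range_self x
  map_target' _ _ := Set.mem_univ _
  left_inv' x _ := by
    ext
    rw [s.retr_eq _ (by simp [chart])]
    simp [chart]
  right_inv' v hv := by
    rw [range_chart] at hv
    ext
    simp [chart, s.retr_eq v hv]
  source_eq := rfl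
  convex_range' := by
    rw [dif_pos (inferInstance : IsRCLikeNormedField ℝ)]
    have : Convex ℝ (Set.range s.chart) := by
      rw [range_chart]
      have hE : {v : s.dir | (v : E) + s.points 0 ∈ s.closedInterior}
          = {v : s.dir | ∀ i, 0 ≤ s.bary i v} := by
        ext v; exact s.mem_iff_bary v
      rw [hE, Set.ofPred_forall]
      exact convex_iInter fun i => (convex_Ici (0 : ℝ)).affine_preimage (s.dirBasis.coord i)
    exact this.convex_isRCLikeNormedField
  nonempty_interior' := by
    have hE : Set.range s.chart = convexHull ℝ (Set.range s.dirBasis) := by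
      rw [range_chart, s.dirBasis.convexHull_eq_nonneg_coord]
      ext v; exact s.mem_iff_bary v
    change (interior (Set.range s.chart)).Nonempty
    rw [hE]
    exact ⟨_, s.dirBasis.centroid_mem_interior_convexHull⟩
  continuous_toFun := by
    exact (continuous_subtype_val.sub continuous_const).subtype_mk _
  continuous_invFun := s.continuous_retr

end Affine.Simplex

/-! ### Lie algebroids -/

section LieAlgebroid

variable {EM H M : Type*} [NormedAddCommGroup EM] [NormedSpace ℝ EM] [TopologicalSpace H]
  (I : ModelWithCorners ℝ EM H) [TopologicalSpace M] [ChartedSpace H M] [IsManifold I ∞ M]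
  (F : Type*) [NormedAddCommGroup F] [NormedSpace ℝ F]
  (A : M → Type*) [TopologicalSpace (TotalSpace F A)]
  [∀ x, AddCommGroup (A x)] [∀ x, Module ℝ (A x)] [∀ x, TopologicalSpace (A x)]
  [FiberBundle F A] [VectorBundle ℝ F A]

variable {I F A} in
/-- The product of a smooth function and a smooth section. -/
def ContMDiffSection.funSMul (f : C^∞⟮I, M; 𝓘(ℝ, ℝ), ℝ⟯) (η : Cₛ^∞⟮I; F, A⟯) : Cₛ^∞⟮I; F, A⟯ :=
  ⟨fun x => f x • η x, f.contMDiff.smul_section η.contMDiff⟩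

/-- A Lie algebroid structure on a smooth vector bundle `A` over `M`: a smooth vector bundle
morphism `A → TM` (the anchor), and a real Lie algebra structure on the space of smooth sections
such that the anchor is a homomorphism of Lie algebras to the vector fields and the Leibniz rule
`[ξ, f η] = f [ξ, η] + (γ(ξ) · f) η` holds. -/
structure LieAlgebroid where
  /-- the anchor, fibre by fibre -/
  anchor : ∀ x : M, A x →ₗ[ℝ] TangentSpace I x
  contMDiff_anchor : ContMDiff (I.prod 𝓘(ℝ, F)) I.tangent ∞
    (fun a : TotalSpace F A => (⟨a.1, anchor a.1 a.2⟩ : TangentBundle I M))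
  /-- the real bilinear bracket on smooth sections -/
  bracket : Cₛ^∞⟮I; F, A⟯ →ₗ[ℝ] Cₛ^∞⟮I; F, A⟯ →ₗ[ℝ] Cₛ^∞⟮I; F, A⟯
  bracket_self : ∀ ξ, bracket ξ ξ = 0
  jacobi : ∀ ξ η ζ,
    bracket ξ (bracket η ζ) + bracket η (bracket ζ ξ) + bracket ζ (bracket ξ η) = 0
  anchor_bracket : ∀ ξ η (x : M), anchor x (bracket ξ η x) =
    VectorField.mlieBracket I (fun y => anchor y (ξ y)) (fun y => anchor y (η y)) x
  leibniz : ∀ (ξ η : Cₛ^∞⟮I; F, A⟯) (f : C^∞⟮I, M; 𝓘(ℝ, ℝ), ℝ⟯),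
    ∀ x : M, bracket ξ (ContMDiffSection.funSMul f η) x =
      f x • bracket ξ η x + mvfderiv I f x (anchor x (ξ x)) • η x

variable {I F A} in
/-- A Lie algebroid is transitive if its anchor is (fibrewise) surjective. -/
def LieAlgebroid.IsTransitive (L : LieAlgebroid I F A) : Prop :=
  ∀ x : M, Function.Surjective (L.anchor x)

end LieAlgebroid

/-! ### Faces of a simplex -/

namespace Affine.Simplex

variable {E : Type*} [NormedAddCommGroup E] [NormedSpace ℝ E] {k : ℕ}

/-- A face of a simplex: a nonempty set of its vertices.  The simplex is a face of itself. -/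
@[ext] structure Face (s : Affine.Simplex ℝ E k) where
  /-- the (indices of the) vertices of the face -/
  verts : Finset (Fin (k + 1))
  nonempty : verts.Nonempty

namespace Face

variable {s : Affine.Simplex ℝ E k}

/-- `β ≤ α` if `β` is a face of `α`. -/
instance : PartialOrder (Face s) := PartialOrder.lift Face.verts fun _ _ h => Face.ext h

/-- The face, as a simplex of its own. -/
def simplex (α : Face s) : Affine.Simplex ℝ E (α.verts.card - 1) :=
  s.face (Nat.sub_add_cancel α.nonempty.card_pos).symm

theorem range_points (α : Face s) : Set.range α.simplex.points = s.points '' α.verts :=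
  s.range_face_points _

theorem subset (α : Face s) : α.simplex.closedInterior ⊆ s.closedInterior :=
  s.closedInterior_face_subset_closedInterior _

theorem subset_of_le {β α : Face s} (h : β ≤ α) :
    β.simplex.closedInterior ⊆ α.simplex.closedInterior := by
  rw [← convexHull_eq_closedInterior, ← convexHull_eq_closedInterior, range_points, range_points]
  exact convexHull_mono (Set.image_mono (Finset.coe_subset.2 h))

/-- The inclusion of a face in the simplex. -/
def incl (α : Face s) (x : α.simplex.Pt) : s.Pt := ⟨x, α.subset x.2⟩

/-- The inclusion of a face in a larger face. -/
def inclOfLE {β α : Face s} (h : β ≤ α) (x : β.simplex.Pt) : α.simplex.Pt :=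
  ⟨x, subset_of_le h x.2⟩

/-- The tangent space of a face (at any of its points), as a subspace of the tangent space of the
simplex.  It is the range of the derivative of the inclusion, see `Face.range_mfderiv_incl`. -/
def tangent (α : Face s) : Submodule ℝ s.dir := α.simplex.dir.comap s.dir.subtype

theorem tangent_mono {β α : Face s} (h : β ≤ α) : β.tangent ≤ α.tangent := by
  refine Submodule.comap_mono (vectorSpan_mono ℝ ?_)
  rw [range_points, range_points]
  exact Set.image_mono (Finset.coe_subset.2 h)

theorem dir_le (α : Face s) : α.simplex.dir ≤ s.dir := by
  refine vectorSpan_mono ℝ ?_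
  rw [range_points]
  exact Set.image_subset_range _ _

/-- The derivative of the inclusion of a face is the inclusion of the tangent spaces. -/
theorem hasMFDerivAt_incl (α : Face s) (x : α.simplex.Pt) :
    HasMFDerivAt α.simplex.model s.model α.incl x
      (LinearMap.toContinuousLinearMap (Submodule.inclusion α.dir_le) :
        α.simplex.dir →L[ℝ] s.dir) := by
  set T : α.simplex.dir →L[ℝ] s.dir :=
    LinearMap.toContinuousLinearMap (Submodule.inclusion α.dir_le) with hT
  have hx0 : α.simplex.points 0 ∈ s.closedInterior :=
    α.subset (α.simplex.point_mem_closedInterior 0)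
  refine ⟨(continuous_subtype_val.subtype_mk _).continuousAt, ?_⟩
  have key : ∀ y : α.simplex.Pt,
      s.chart (α.incl y) = T (α.simplex.chart y) + s.chart ⟨_, hx0⟩ := by
    intro y
    ext
    simp [chart, incl, hT]
  have h : HasFDerivWithinAt (fun v => T v + s.chart ⟨_, hx0⟩) T
      (Set.range α.simplex.chart) (α.simplex.chart x) :=
    (T.hasFDerivAt.add_const _).hasFDerivWithinAt
  refine HasFDerivWithinAt.congr' (f := fun v => T v + s.chart ⟨_, hx0⟩) h ?_
    (Set.mem_range_self x)
  rintro _ ⟨y, rfl⟩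
  change s.chart (α.incl (α.simplex.model.symm (α.simplex.model y))) = _
  rw [α.simplex.model.left_inv]
  exact key y

theorem range_mfderiv_incl (α : Face s) (x : α.simplex.Pt) :
    (LinearMap.range (mfderiv α.simplex.model s.model α.incl x).toLinearMap :
      Submodule ℝ s.dir) = α.tangent := by
  rw [(α.hasMFDerivAt_incl x).mfderiv]
  exact Submodule.range_inclusion _ _ α.dir_le

end Face

/-- The simplicial complex made by the simplex and all its faces, as a set of faces. -/
def allFaces (s : Affine.Simplex ℝ E k) : Set (Face s) := Set.univ

/-- The boundary of the simplex: the simplicial complex of all proper faces. -/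
def bdFaces (s : Affine.Simplex ℝ E k) : Set (Face s) := {α | α.verts ≠ Finset.univ}

end Affine.Simplex

/-! ### Restriction of a Lie algebroid to the faces, and piecewise smooth forms -/

namespace LieAlgebroid

open Affine.Simplex

variable {E : Type*} [NormedAddCommGroup E] [NormedSpace ℝ E] {k : ℕ}
  {s : Affine.Simplex ℝ E k}
  {F : Type*} [NormedAddCommGroup F] [NormedSpace ℝ F]
  {A : s.Pt → Type*} [TopologicalSpace (TotalSpace F A)]
  [∀ x, AddCommGroup (A x)] [∀ x, Module ℝ (A x)] [∀ x, TopologicalSpace (A x)]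
  [FiberBundle F A] [VectorBundle ℝ F A]

/-- The fibre at a point `x` of the face `α` of the restriction of the Lie algebroid `A` to `α`,
i.e. of the inverse image of `A` under the inclusion of `α`: the elements of `A x` whose anchor is
tangent to `α`. (An element of the inverse image is a pair of `a : A x` and a vector `v` tangent
to `α` with `anchor a = v`; such a pair is determined by `a`.) -/
def faceFiber (L : LieAlgebroid s.model F A) (α : Face s) (x : α.simplex.Pt) :
    Submodule ℝ (A (α.incl x)) :=
  Submodule.comap (L.anchor (α.incl x)) (α.tangent : Submodule ℝ (TangentSpace s.model (α.incl x)))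

/-- For `β` a face of `α`, the fibres of the restriction to `β` are subspaces of those of the
restriction to `α`. -/
theorem faceFiber_le (L : LieAlgebroid s.model F A) {β α : Face s} (h : β ≤ α)
    (x : β.simplex.Pt) : L.faceFiber β x ≤ L.faceFiber α (Face.inclOfLE h x) :=
  Submodule.comap_mono (Face.tangent_mono h)

/-- The inclusion of these fibres, for `β` a face of `α`. -/
def faceFiberIncl (L : LieAlgebroid s.model F A) {β α : Face s} (h : β ≤ α) (x : β.simplex.Pt) :
    L.faceFiber β x →ₗ[ℝ] L.faceFiber α (Face.inclOfLE h x) where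
  toFun a := ⟨(a : A (β.incl x)), L.faceFiber_le h x a.2⟩
  map_add' _ _ := rfl
  map_smul' _ _ := rfl

/-- Smoothness, on a subset `U` of the face `α`, of a section of the restriction of `A` to `α`. -/
def IsSmoothSectionOn (L : LieAlgebroid s.model F A) (α : Face s) (U : Set α.simplex.Pt)
    (σ : ∀ x, L.faceFiber α x) : Prop :=
  ContMDiffOn α.simplex.model (s.model.prod 𝓘(ℝ, F)) ∞
    (fun x => (⟨α.incl x, (σ x : A (α.incl x))⟩ : TotalSpace F A)) U

/-- A smooth form of degree `p` on the restriction of `A` to the face `α`: at each point an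
alternating `p`-form on the fibre, such that evaluating it on smooth sections over any open
subset of the face gives a smooth function there. -/
@[ext] structure FaceForm (L : LieAlgebroid s.model F A) (α : Face s) (p : ℕ) where
  /-- the alternating form at each point of the face -/
  toFun : ∀ x : α.simplex.Pt, (L.faceFiber α x) [⋀^Fin p]→ₗ[ℝ] ℝ
  smooth : ∀ U : Set α.simplex.Pt, IsOpen U → ∀ σ : Fin p → ∀ x, L.faceFiber α x,
    (∀ i, L.IsSmoothSectionOn α U (σ i)) →
      ContMDiffOn α.simplex.model 𝓘(ℝ, ℝ) ∞ (fun x => toFun x (fun i => σ i x)) U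

/-- The form `τ` on the face `α` restricts to the form `θ` on the face `β` of `α`. -/
def FaceForm.RestrictsTo {L : LieAlgebroid s.model F A} {α β : Face s} {p : ℕ}
    (τ : FaceForm L α p) (h : β ≤ α) (θ : FaceForm L β p) : Prop :=
  ∀ x : β.simplex.Pt,
    (τ.toFun (Face.inclOfLE h x)).compLinearMap (L.faceFiberIncl h x)
      = θ.toFun x

/-- A piecewise smooth form of degree `p` on the complex of Lie algebroids given by the
restrictions of `A` to the faces in `K`: a smooth form on the restriction of `A` to each face
in `K`, compatible with restriction to faces. -/
@[ext] structure PiecewiseForm (L : LieAlgebroid s.model F A) (K : Set (Face s)) (p : ℕ) where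
  /-- the smooth form on each face in `K` -/
  form : ∀ α ∈ K, FaceForm L α p
  compatible : ∀ (α : Face s) (hα : α ∈ K) (β : Face s) (hβ : β ∈ K) (h : β ≤ α),
    (form α hα).RestrictsTo h (form β hβ)

/-- The restriction of a piecewise smooth form to a subcomplex. -/
def PiecewiseForm.restrict {L : LieAlgebroid s.model F A} {K K' : Set (Face s)} {p : ℕ}
    (τ : PiecewiseForm L K p) (h : K' ⊆ K) : PiecewiseForm L K' p where
  form α hα := τ.form α (h hα)
  compatible α hα β hβ hle := τ.compatible α (h hα) β (h hβ) hle

end LieAlgebroid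

end

/-! A form on all of `A` whose restriction to every proper face is the given one yields forms on all
faces at once, so it suffices to extend `ξ` to a smooth family of alternating forms on the fibres of
`A`. Being an extension is preserved by pointwise combinations with weights of sum one, so a
partition of unity reduces this to a neighbourhood of a point `x₀` (`exists_local_extension`).

Near `x₀`, transitivity gives a frame in which the anchor is a constant surjection `F → s.dir`
(`exists_flatFrame`). Let `J` be the set of vertices whose barycentric coordinate vanishes at `x₀`,
and `m` a vertex outside `J`. For `S ⊆ J`, the affine map `c_S` moving the vertices of `S` to `m`
retracts the simplex onto the face opposite to `S`, and fixes `x₀`; the frame lifts it to the fibres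
(`shift`, `toFace`). The extension is the inclusion-exclusion sum of `(-1)^(|S|+1) c_S^* ξ` over
nonempty `S ⊆ J`.

On a proper face missing `l`, where necessarily `l ∈ J` near `x₀`, the terms of `S` and `S ∪ {l}`
cancel for nonempty `S` not containing `l` (`pullback_insert`). The term of `{l}` remains, and it
restricts to `ξ` because `c_{l}` is the identity there (`pullback_singleton`). -/

noncomputable section

namespace Affine.Simplex

variable {E : Type*} [NormedAddCommGroup E] [NormedSpace ℝ E] {k : ℕ}

/-! ### Barycentric coordinates and faces -/

/-- The linear part of a barycentric coordinate. -/
def coordLin (s : Affine.Simplex ℝ E k) (i : Fin (k + 1)) : s.dir →ₗ[ℝ] ℝ :=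
  (s.dirBasis.coord i).linear

/-- The edge vector from the vertex `m` to the vertex `i`. -/
def edge (s : Affine.Simplex ℝ E k) (m i : Fin (k + 1)) : s.dir := s.dirBasis i - s.dirBasis m

/-- The barycentric coordinates of a point of the simplex. -/
def coordPt (s : Affine.Simplex ℝ E k) (i : Fin (k + 1)) (x : s.Pt) : ℝ := s.bary i (s.chart x)

theorem coe_edge (s : Affine.Simplex ℝ E k) (m i : Fin (k + 1)) :
    (s.edge m i : E) = s.points i - s.points m := by
  simp [edge, dirBasis_apply]

theorem coe_chart (s : Affine.Simplex ℝ E k) (x : s.Pt) : (s.chart x : E) = x - s.points 0 := rfl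

theorem continuous_chart (s : Affine.Simplex ℝ E k) : Continuous s.chart :=
  (continuous_subtype_val.sub continuous_const).subtype_mk _

theorem continuous_coordPt (s : Affine.Simplex ℝ E k) (i : Fin (k + 1)) :
    Continuous (s.coordPt i) :=
  (continuous_barycentric_coord s.dirBasis i).comp s.continuous_chart

theorem coordPt_nonneg (s : Affine.Simplex ℝ E k) (i : Fin (k + 1)) (x : s.Pt) :
    0 ≤ s.coordPt i x :=
  (s.mem_iff_bary _).1 (by simp [chart]) i

theorem sum_coordPt (s : Affine.Simplex ℝ E k) (x : s.Pt) : ∑ i, s.coordPt i x = 1 :=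
  s.dirBasis.sum_coord_apply_eq_one _

theorem exists_coordPt_ne_zero (s : Affine.Simplex ℝ E k) (x : s.Pt) : ∃ i, s.coordPt i x ≠ 0 := by
  by_contra! h
  have := s.sum_coordPt x
  simp [h] at this

theorem sum_coordPt_smul (s : Affine.Simplex ℝ E k) (x : s.Pt) :
    ∑ i, s.coordPt i x • s.points i = (x : E) := by
  simpa [coe_chart] using! s.sum_bary_smul (s.chart x)

theorem coordLin_chart_sub (s : Affine.Simplex ℝ E k) (i : Fin (k + 1)) (x y : s.Pt) :
    s.coordLin i (s.chart x - s.chart y) = s.coordPt i x - s.coordPt i y :=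
  (s.dirBasis.coord i).linearMap_vsub _ _

/-- The linear parts of the coordinates sum to zero, so the base vertex `m` drops out and can be any
vertex. -/
theorem sum_coordLin_smul_edge (s : Affine.Simplex ℝ E k) (m : Fin (k + 1)) (v : s.dir) :
    ∑ i, s.coordLin i v • s.edge m i = v := by
  have hc : ∀ i, s.coordLin i v = s.bary i v - s.bary i 0 := fun i => by
    simpa [coordLin] using (s.dirBasis.coord i).linearMap_vsub v 0
  have h1 := s.dirBasis.linear_combination_coord_eq_self v
  have h2 := s.dirBasis.linear_combination_coord_eq_self 0
  have h3 := s.dirBasis.sum_coord_apply_eq_one v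
  have h4 := s.dirBasis.sum_coord_apply_eq_one 0
  simp only [hc, edge, smul_sub, sub_smul, Finset.sum_sub_distrib, ← Finset.sum_smul, h1, h2, h3,
    h4]
  simp

/-- The inclusion of `s.dir` as the affine span of the simplex. -/
def dirAffine (s : Affine.Simplex ℝ E k) : s.dir →ᵃ[ℝ] E :=
  s.dir.subtype.toAffineMap + AffineMap.const ℝ _ (s.points 0)

theorem dirAffine_apply (s : Affine.Simplex ℝ E k) (v : s.dir) :
    s.dirAffine v = v + s.points 0 := rfl

theorem dirAffine_image_dirBasis (s : Affine.Simplex ℝ E k) (t : Set (Fin (k + 1))) :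
    s.dirAffine '' (s.dirBasis '' t) = s.points '' t := by
  rw [Set.image_image]
  refine Set.image_congr fun i _ => ?_
  rw [dirAffine_apply, dirBasis_apply, sub_add_cancel]

/-! ### Vanishing of coordinates on faces and on their tangent spaces -/

namespace Face

variable {s : Affine.Simplex ℝ E k}

theorem closedInterior_eq (α : Face s) :
    α.simplex.closedInterior = convexHull ℝ (s.points '' α.verts) := by
  rw [← convexHull_eq_closedInterior, range_points]

theorem coordPt_incl_eq_zero (α : Face s) {i : Fin (k + 1)} (hi : i ∉ α.verts)
    (x : α.simplex.Pt) : s.coordPt i (α.incl x) = 0 := by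
  have hx : (x : E) ∈ s.dirAffine '' convexHull ℝ (s.dirBasis '' α.verts) := by
    rw [AffineMap.image_convexHull, dirAffine_image_dirBasis]
    exact α.closedInterior_eq.subset x.2
  obtain ⟨v, hv, hvx⟩ := hx
  have hc : s.chart (α.incl x) = v := by
    ext
    rw [coe_chart]
    change (x : E) - _ = _
    rw [← hvx, dirAffine_apply, add_sub_cancel_right]
  have hsub : convexHull ℝ (s.dirBasis '' α.verts) ⊆ (s.dirBasis.coord i) ⁻¹' {0} := by
    refine convexHull_min ?_ ((convex_singleton (0 : ℝ)).affine_preimage _)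
    rintro _ ⟨j, hj, rfl⟩
    exact s.dirBasis.coord_apply_ne (ne_of_mem_of_not_mem (Finset.mem_coe.1 hj) hi).symm
  rw [coordPt, hc]
  exact hsub hv

theorem tangent_eq (α : Face s) : α.tangent = vectorSpan ℝ (s.dirBasis '' α.verts) := by
  have h : α.simplex.dir = (vectorSpan ℝ (s.dirBasis '' α.verts)).map s.dir.subtype := by
    rw [dir, range_points, ← dirAffine_image_dirBasis, ← AffineMap.map_vectorSpan]
    congr 1
    ext
    simp [dirAffine]
  rw [tangent, h, Submodule.comap_map_eq_of_injective s.dir.injective_subtype]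

/-- Infinitesimal counterpart of `coordPt_incl_eq_zero`. Together they make moving a vertex outside
`α` invisible along `α`, for points and for tangent vectors. -/
theorem coordLin_eq_zero (α : Face s) {i : Fin (k + 1)} (hi : i ∉ α.verts) {v : s.dir}
    (hv : v ∈ α.tangent) : s.coordLin i v = 0 := by
  rw [tangent_eq] at hv
  have hle : vectorSpan ℝ (s.dirBasis '' α.verts) ≤ LinearMap.ker (s.coordLin i) := by
    rw [vectorSpan_def, Submodule.span_le]
    rintro _ ⟨_, ⟨a, ha, rfl⟩, _, ⟨b, hb, rfl⟩, rfl⟩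
    have h := (s.dirBasis.coord i).linearMap_vsub (s.dirBasis a) (s.dirBasis b)
    rw [s.dirBasis.coord_apply_ne (ne_of_mem_of_not_mem (Finset.mem_coe.1 ha) hi).symm,
      s.dirBasis.coord_apply_ne (ne_of_mem_of_not_mem (Finset.mem_coe.1 hb) hi).symm] at h
    rw [vsub_self] at h
    exact h
  exact hle hv

theorem edge_mem_tangent (α : Face s) {m i : Fin (k + 1)} (hm : m ∈ α.verts) (hi : i ∈ α.verts) :
    s.edge m i ∈ α.tangent := by
  rw [tangent_eq]
  exact vsub_mem_vectorSpan ℝ (Set.mem_image_of_mem _ hi) (Set.mem_image_of_mem _ hm)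

/-- The face whose vertices are those outside `S`, where `m` is one of them. -/
def compl (s : Affine.Simplex ℝ E k) {m : Fin (k + 1)} {S : Finset (Fin (k + 1))} (hm : m ∉ S) :
    Face s := ⟨Sᶜ, ⟨m, by simpa using hm⟩⟩

theorem compl_mem_bdFaces {m : Fin (k + 1)} {S : Finset (Fin (k + 1))} (hm : m ∉ S)
    (hS : S.Nonempty) : compl s hm ∈ s.bdFaces := by
  obtain ⟨i, hi⟩ := hS
  intro h
  have : i ∈ (compl s hm).verts := h ▸ Finset.mem_univ i
  simp [compl, hi] at this

theorem compl_le_compl {m : Fin (k + 1)} {S S' : Finset (Fin (k + 1))} (hm : m ∉ S) (hm' : m ∉ S')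
    (h : S ⊆ S') : compl s hm' ≤ compl s hm :=
  Finset.compl_subset_compl.2 h

end Face

/-! ### Collapsing vertices of a simplex -/

/-- In the global charts such a map is the restriction of an affine map between finite-dimensional
spaces. Only differences enter the hypothesis, so the choice of origins is irrelevant. -/
theorem contMDiff_of_affine {l : ℕ} (s : Affine.Simplex ℝ E k) (s' : Affine.Simplex ℝ E l)
    (f : s.Pt → s'.Pt) (T : s.dir →ₗ[ℝ] s'.dir)
    (h : ∀ x y, s'.chart (f x) - s'.chart (f y) = T (s.chart x - s.chart y)) :
    ContMDiff s.model s'.model ∞ f := by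
  obtain ⟨y⟩ : Nonempty s.Pt := ⟨⟨_, s.point_mem_closedInterior 0⟩⟩
  let G : s.dir → s'.dir := fun v =>
    LinearMap.toContinuousLinearMap T (v - s.chart y) + s'.chart (f y)
  have hG : ContDiff ℝ ∞ G := by fun_prop
  have hGf : ∀ x, G (s.model x) = s'.model (f x) := fun x =>
    (sub_eq_iff_eq_add.1 (h x y)).symm
  have hf : f = s'.model.symm ∘ (G ∘ s.model) := by
    ext1 x
    rw [Function.comp_apply, Function.comp_apply, hGf, s'.model.left_inv]
  rw [hf]
  refine (s'.model.contMDiffOn_symm (n := ∞)).comp_contMDiff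
    (hG.contMDiff.comp s.model.contMDiff) fun x => ?_
  rw [Function.comp_apply, hGf]
  exact Set.mem_range_self _

theorem Face.contMDiff_incl {s : Affine.Simplex ℝ E k} (α : Face s) :
    ContMDiff α.simplex.model s.model ∞ α.incl :=
  contMDiff_of_affine _ _ _ (Submodule.inclusion α.dir_le) fun x y => by
    ext
    simp [coe_chart, incl]

/-- The linear part of the affine map that moves the vertices in `S` to the vertex `m`. -/
def collapseLin (s : Affine.Simplex ℝ E k) (m : Fin (k + 1)) (S : Finset (Fin (k + 1))) :
    s.dir →ₗ[ℝ] s.dir :=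
  LinearMap.id - ∑ i ∈ S, (s.coordLin i).smulRight (s.edge m i)

theorem collapseLin_apply (s : Affine.Simplex ℝ E k) (m : Fin (k + 1)) (S : Finset (Fin (k + 1)))
    (v : s.dir) : s.collapseLin m S v = v - ∑ i ∈ S, s.coordLin i v • s.edge m i := by
  simp [collapseLin]

/-- Expand `v` in the edges issuing from `m`: the subtracted terms are those ending in `S`, and the
remaining edges join vertices outside `S`. -/
theorem collapseLin_mem_tangent (s : Affine.Simplex ℝ E k) {m : Fin (k + 1)}
    {S : Finset (Fin (k + 1))} (hm : m ∉ S) (v : s.dir) :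
    s.collapseLin m S v ∈ (Face.compl s hm).tangent := by
  have h : s.collapseLin m S v = ∑ i ∈ Sᶜ, s.coordLin i v • s.edge m i := by
    rw [collapseLin_apply, sub_eq_iff_eq_add, Finset.sum_compl_add_sum, sum_coordLin_smul_edge]
  rw [h]
  exact Submodule.sum_mem _ fun i hi => Submodule.smul_mem _ _
    (Face.edge_mem_tangent _ (Finset.mem_compl.2 hm) hi)

/-- The affine map of the simplex to a face that moves the vertices in `S` to the vertex `m` and
fixes the others, as a map to the ambient space. -/
def collapseAux (s : Affine.Simplex ℝ E k) (m : Fin (k + 1)) (S : Finset (Fin (k + 1)))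
    (x : s.Pt) : E :=
  x - ∑ i ∈ S, s.coordPt i x • (s.edge m i : E)

theorem collapseAux_mem (s : Affine.Simplex ℝ E k) {m : Fin (k + 1)}
    {S : Finset (Fin (k + 1))} (hm : m ∉ S) (x : s.Pt) :
    s.collapseAux m S x ∈ (Face.compl s hm).simplex.closedInterior := by
  -- The image is the convex combination with the same weights, taken at the moved vertices.
  have h : s.collapseAux m S x
      = ∑ i, s.coordPt i x • s.points (if i ∈ S then m else i) := by
    rw [collapseAux, ← Finset.sum_ite_mem_eq S, sub_eq_iff_eq_add, ← Finset.sum_add_distrib]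
    refine (s.sum_coordPt_smul x).symm.trans (Finset.sum_congr rfl fun i _ => ?_)
    split_ifs
    · rw [coe_edge, ← smul_add, add_sub_cancel]
    · rw [add_zero]
  rw [h, Face.closedInterior_eq]
  refine (convex_convexHull ℝ _).sum_mem (fun i _ => s.coordPt_nonneg i x) (s.sum_coordPt x)
    fun i _ => subset_convexHull ℝ _ (Set.mem_image_of_mem _ ?_)
  simp only [Face.compl, Finset.coe_compl, Set.mem_compl_iff, Finset.mem_coe]
  split_ifs with hi
  exacts [hm, hi]

/-- The affine map of the simplex to a face that moves the vertices in `S` to the vertex `m` and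
fixes the others. -/
def collapse (s : Affine.Simplex ℝ E k) {m : Fin (k + 1)} {S : Finset (Fin (k + 1))}
    (hm : m ∉ S) (x : s.Pt) : (Face.compl s hm).simplex.Pt :=
  ⟨s.collapseAux m S x, s.collapseAux_mem hm x⟩

theorem contMDiff_collapse (s : Affine.Simplex ℝ E k) {m : Fin (k + 1)}
    {S : Finset (Fin (k + 1))} (hm : m ∉ S) :
    ContMDiff s.model (Face.compl s hm).simplex.model ∞ (s.collapse hm) := by
  refine contMDiff_of_affine _ _ _ (LinearMap.codRestrict _
    (s.dir.subtype ∘ₗ s.collapseLin m S) (s.collapseLin_mem_tangent hm)) fun x y => ?_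
  ext
  change (s.collapseAux m S x - _) - (s.collapseAux m S y - _) =
    ((s.collapseLin m S (s.chart x - s.chart y) : s.dir) : E)
  simp only [AddSubgroupClass.coe_sub, coe_chart, collapseAux, collapseLin_apply,
    coordLin_chart_sub, AddSubmonoidClass.coe_finsetSum, Submodule.coe_smul, sub_smul,
    Finset.sum_sub_distrib]
  abel

theorem incl_collapse_eq_self (s : Affine.Simplex ℝ E k) {m : Fin (k + 1)}
    {S : Finset (Fin (k + 1))} (hm : m ∉ S) {x : s.Pt} (hx : ∀ i ∈ S, s.coordPt i x = 0) :
    (Face.compl s hm).incl (s.collapse hm x) = x := by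
  ext
  change s.collapseAux m S x = x
  rw [collapseAux, Finset.sum_eq_zero fun i hi => by rw [hx i hi, zero_smul], sub_zero]

theorem incl_collapse_insert (s : Affine.Simplex ℝ E k) {m l : Fin (k + 1)}
    {S : Finset (Fin (k + 1))} (hm : m ∉ S) (hm' : m ∉ insert l S) (hl : l ∉ S) {x : s.Pt}
    (hx : s.coordPt l x = 0) :
    (Face.compl s hm').incl (s.collapse hm' x) = (Face.compl s hm).incl (s.collapse hm x) := by
  ext
  change s.collapseAux m _ x = s.collapseAux m _ x
  rw [collapseAux, collapseAux, Finset.sum_insert hl, hx, zero_smul, zero_add]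

end Affine.Simplex

namespace LieAlgebroid

open Affine.Simplex

variable {E : Type*} [NormedAddCommGroup E] [NormedSpace ℝ E] {k : ℕ}
  {s : Affine.Simplex ℝ E k}
  {F : Type*} [NormedAddCommGroup F] [NormedSpace ℝ F]
  {A : s.Pt → Type*} [TopologicalSpace (TotalSpace F A)]
  [∀ x, AddCommGroup (A x)] [∀ x, Module ℝ (A x)] [∀ x, TopologicalSpace (A x)]
  [FiberBundle F A] [VectorBundle ℝ F A]

/-! ### Local trivialisations with constant anchor -/

/-- A smooth trivialisation of a Lie algebroid over a set `W` in which the anchor is a constant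
linear map, extended by zero outside `W`. -/
structure FlatFrame (L : LieAlgebroid s.model F A) (W : Set s.Pt) where
  /-- the anchor in the trivialisation -/
  symbol : F →ₗ[ℝ] s.dir
  /-- a right inverse of the anchor in the trivialisation -/
  lift : s.dir →ₗ[ℝ] F
  symbol_lift : ∀ v, symbol (lift v) = v
  /-- the map from the model fibre to the fibres -/
  toFiber : ∀ x, F →ₗ[ℝ] A x
  /-- the map from the fibres to the model fibre -/
  ofFiber : ∀ x, A x →ₗ[ℝ] F
  toFiber_ofFiber : ∀ x ∈ W, ∀ a, toFiber x (ofFiber x a) = a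
  toFiber_of_notMem : ∀ x ∉ W, toFiber x = 0
  anchor_toFiber : ∀ x ∈ W, ∀ w, L.anchor x (toFiber x w) = symbol w
  smooth_toFiber : ∀ w, ContMDiffOn s.model (s.model.prod 𝓘(ℝ, F)) ∞
    (fun x => (⟨x, toFiber x w⟩ : TotalSpace F A)) W
  smooth_ofFiber : ContMDiffOn (s.model.prod 𝓘(ℝ, F)) 𝓘(ℝ, F) ∞
    (fun a : TotalSpace F A => ofFiber a.1 a.2) (TotalSpace.proj ⁻¹' W)

/-- A family of linear maps on a finite-dimensional space is smooth if it is pointwise smooth. -/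
theorem contMDiffOn_toContinuousLinearMap {EM H M V V' : Type*} [NormedAddCommGroup EM]
    [NormedSpace ℝ EM] [TopologicalSpace H] {I : ModelWithCorners ℝ EM H} [TopologicalSpace M]
    [ChartedSpace H M] [NormedAddCommGroup V] [NormedSpace ℝ V] [FiniteDimensional ℝ V]
    [NormedAddCommGroup V'] [NormedSpace ℝ V'] {g : M → V →ₗ[ℝ] V'} {U : Set M}
    (hg : ∀ v, ContMDiffOn I 𝓘(ℝ, V') ∞ (fun x => g x v) U) :
    ContMDiffOn I 𝓘(ℝ, V →L[ℝ] V') ∞ (fun x => LinearMap.toContinuousLinearMap (g x)) U := by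
  let b := Module.finBasis ℝ V
  have h : (fun x => LinearMap.toContinuousLinearMap (g x)) = fun x =>
      ∑ j, ContinuousLinearMap.smulRightL ℝ V V' (LinearMap.toContinuousLinearMap (b.coord j))
        (g x (b j)) := by
    funext x
    ext v
    rw [sum_apply]
    change g x v = ∑ j, b.repr v j • g x (b j)
    simp only [← map_smul, ← map_sum, b.sum_repr]
  rw [h]
  exact contMDiffOn_finsetSum fun j _ =>
    (ContinuousLinearMap.contMDiff _).comp_contMDiffOn (hg (b j))

/-- The global chart trivialises the tangent bundle, so the anchor of a frame section may be treated
as a function with values in the fixed space `s.dir`. -/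
theorem contMDiffOn_anchor_symm [ContMDiffVectorBundle ∞ F A s.model]
    (L : LieAlgebroid s.model F A) (e : Bundle.Trivialization F (TotalSpace.proj (F := F) (E := A)))
    [MemTrivializationAtlas e] (f : F) :
    ContMDiffOn s.model 𝓘(ℝ, s.dir) ∞
      (fun x => (L.anchor x (e.symmₗ ℝ x f) : s.dir)) e.baseSet := by
  have h1 : ContMDiffOn s.model (s.model.prod 𝓘(ℝ, F)) ∞
      (fun x => (⟨x, e.symmₗ ℝ x f⟩ : TotalSpace F A)) e.baseSet := by
    rw [e.contMDiffOn_section_baseSet_iff]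
    exact (contMDiffOn_const (c := f)).congr fun x hx => by rw [e.coe_symmₗ hx, e.apply_mk_symm hx]
  intro x hx
  have h2 := ((L.contMDiff_anchor.comp_contMDiffOn h1) x hx)
  have h3 := (Bundle.contMDiffWithinAt_totalSpace.1 h2).2
  simpa using! h3

/-- Let `g x` be the anchor in a trivialisation and `R` a right inverse of `g x₀`, which exists by
transitivity. Then `B x = 1 + R (g x - g x₀)` satisfies `g x₀ ∘ B x = g x` and `B x₀ = 1`. Where `B
x` is invertible, changing the frame by its inverse turns the anchor into the constant map `g x₀`.
-/
theorem exists_flatFrame [FiniteDimensional ℝ F] [ContMDiffVectorBundle ∞ F A s.model]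
    (L : LieAlgebroid s.model F A) (hL : L.IsTransitive) (x₀ : s.Pt) :
    ∃ W : Set s.Pt, IsOpen W ∧ x₀ ∈ W ∧ Nonempty (FlatFrame L W) := by
  classical
  let e := trivializationAt F A x₀
  have hx₀ : x₀ ∈ e.baseSet := FiberBundle.mem_baseSet_trivializationAt' x₀
  let g : s.Pt → F →ₗ[ℝ] s.dir := fun x => L.anchor x ∘ₗ e.symmₗ ℝ x
  have hsurj : Function.Surjective (g x₀) := by
    intro v
    obtain ⟨a, rfl⟩ := hL x₀ v
    refine ⟨e.linearMapAt ℝ x₀ a, ?_⟩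
    change L.anchor x₀ (e.symmₗ ℝ x₀ _) = _
    rw [e.symmₗ_linearMapAt hx₀]
  obtain ⟨R, hR⟩ := (g x₀).exists_rightInverse_of_surjective (LinearMap.range_eq_top.2 hsurj)
  have hR' : ∀ v, g x₀ (R v) = v := fun v => LinearMap.congr_fun hR v
  let B : s.Pt → F →L[ℝ] F := fun x =>
    LinearMap.toContinuousLinearMap (LinearMap.id + R ∘ₗ (g x - g x₀))
  have hB_apply : ∀ x w, B x w = w + R (g x w - g x₀ w) := fun x w => rfl
  have hgB : ∀ x w, g x₀ (B x w) = g x w := fun x w => by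
    rw [hB_apply, map_add, hR', add_sub_cancel]
  have hB : ContMDiffOn s.model 𝓘(ℝ, F →L[ℝ] F) ∞ B e.baseSet := by
    refine contMDiffOn_toContinuousLinearMap fun v => ?_
    have hv : ContMDiffOn s.model 𝓘(ℝ, s.dir) ∞ (fun x => g x v) e.baseSet :=
      contMDiffOn_anchor_symm L e v
    exact contMDiffOn_const.add
      ((LinearMap.toContinuousLinearMap R).contMDiff.comp_contMDiffOn (hv.sub contMDiffOn_const))
  let W : Set s.Pt := e.baseSet ∩ B ⁻¹' {b | IsUnit b}
  have hWe : W ⊆ e.baseSet := Set.inter_subset_left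
  have hWo : IsOpen W := hB.continuousOn.isOpen_inter_preimage e.open_baseSet Units.isOpen
  have hB₀ : B x₀ = 1 := by
    ext w
    simp [hB_apply]
  have hinv : ContMDiffOn s.model 𝓘(ℝ, F →L[ℝ] F) ∞ (fun x => Ring.inverse (B x)) W := by
    intro x hx
    obtain ⟨u, hu⟩ : IsUnit (B x) := hx.2
    have h := contDiffAt_ringInverse ℝ (n := ∞) u
    rw [hu] at h
    exact h.contMDiffAt.comp_contMDiffWithinAt x ((hB x hx.1).mono hWe)
  refine ⟨W, hWo, ⟨hx₀, by simp [hB₀]⟩, ⟨{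
    symbol := g x₀
    lift := R
    symbol_lift := hR'
    toFiber := fun x => if x ∈ W then e.symmₗ ℝ x ∘ₗ (Ring.inverse (B x)).toLinearMap else 0
    ofFiber := fun x => (B x).toLinearMap ∘ₗ e.linearMapAt ℝ x
    toFiber_ofFiber := ?_
    toFiber_of_notMem := fun x hx => if_neg hx
    anchor_toFiber := ?_
    smooth_toFiber := ?_
    smooth_ofFiber := ?_ }⟩⟩
  · intro x hx a
    rw [if_pos hx]
    have h : (Ring.inverse (B x)) (B x (e.linearMapAt ℝ x a)) = e.linearMapAt ℝ x a := by
      rw [← mul_apply_eq_comp, Ring.inverse_mul_cancel _ hx.2,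
        one_apply_eq_self]
    change e.symmₗ ℝ x ((Ring.inverse (B x)) (B x (e.linearMapAt ℝ x a))) = a
    rw [h, e.symmₗ_linearMapAt hx.1]
  · intro x hx w
    rw [if_pos hx]
    change g x (Ring.inverse (B x) w) = g x₀ w
    rw [← hgB, ← mul_apply_eq_comp, Ring.mul_inverse_cancel _ hx.2,
      one_apply_eq_self]
  · intro w
    have h1 : ContMDiffOn s.model 𝓘(ℝ, F) ∞ (fun x => Ring.inverse (B x) w) W :=
      hinv.clm_apply contMDiffOn_const
    have h2 : ContMDiffOn s.model (s.model.prod 𝓘(ℝ, F)) ∞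
        (fun x => (⟨x, e.symmₗ ℝ x (Ring.inverse (B x) w)⟩ : TotalSpace F A)) W := by
      refine (e.contMDiffOn_iff fun x hx => e.mem_source.2 (hWe hx)).2 ⟨contMDiffOn_id, ?_⟩
      exact h1.congr fun x hx => by rw [e.coe_symmₗ (hWe hx), e.apply_mk_symm (hWe hx)]
    refine h2.congr fun x hx => ?_
    rw [if_pos hx]
    rfl
  · have hm : Set.MapsTo (TotalSpace.proj (F := F) (E := A)) (TotalSpace.proj ⁻¹' W) e.baseSet :=
      fun a ha => hWe ha
    have h1 := hB.comp (Bundle.contMDiffOn_proj (n := ∞) A (IB := s.model)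
      (s := TotalSpace.proj ⁻¹' W)) hm
    have h2 : ContMDiffOn (s.model.prod 𝓘(ℝ, F)) 𝓘(ℝ, F) ∞
        (fun a : TotalSpace F A => (e a).2) (TotalSpace.proj ⁻¹' W) :=
      contMDiff_snd.comp_contMDiffOn (e.contMDiffOn.mono fun a ha => e.mem_source.2 (hWe ha))
    refine (h1.clm_apply h2).congr fun a ha => ?_
    change B a.1 (e.linearMapAt ℝ a.1 a.2) = B a.1 (e a).2
    rw [e.coe_linearMapAt_of_mem (hWe ha)]

end LieAlgebroid

namespace LieAlgebroid

open Affine.Simplex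

variable {E : Type*} [NormedAddCommGroup E] [NormedSpace ℝ E] {k : ℕ}
  {s : Affine.Simplex ℝ E k}
  {F : Type*} [NormedAddCommGroup F] [NormedSpace ℝ F]
  {A : s.Pt → Type*} [TopologicalSpace (TotalSpace F A)]
  [∀ x, AddCommGroup (A x)] [∀ x, Module ℝ (A x)] [∀ x, TopologicalSpace (A x)]
  [FiberBundle F A] [VectorBundle ℝ F A]

/-! ### Pulling back forms along the collapse of a simplex to a face -/

namespace FlatFrame

variable {L : LieAlgebroid s.model F A} {W : Set s.Pt} (Φ : FlatFrame L W)

/-- A lift of `collapseLin` to the model fibre. -/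
def shift (m : Fin (k + 1)) (S : Finset (Fin (k + 1))) : F →ₗ[ℝ] F :=
  LinearMap.id - ∑ i ∈ S, (s.coordLin i ∘ₗ Φ.symbol).smulRight (Φ.lift (s.edge m i))

theorem shift_apply (m : Fin (k + 1)) (S : Finset (Fin (k + 1))) (w : F) :
    Φ.shift m S w = w - ∑ i ∈ S, s.coordLin i (Φ.symbol w) • Φ.lift (s.edge m i) := by
  simp [shift]

/-- This is what makes the shifted vectors tangent to the face opposite to `S`, so that a form on
that face can be evaluated on them. -/
theorem symbol_shift (m : Fin (k + 1)) (S : Finset (Fin (k + 1))) (w : F) :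
    Φ.symbol (Φ.shift m S w) = s.collapseLin m S (Φ.symbol w) := by
  simp [shift_apply, collapseLin_apply, Φ.symbol_lift]

theorem shift_insert {m l : Fin (k + 1)} {S : Finset (Fin (k + 1))} (hl : l ∉ S) {w : F}
    (hw : s.coordLin l (Φ.symbol w) = 0) : Φ.shift m (insert l S) w = Φ.shift m S w := by
  rw [shift_apply, shift_apply, Finset.sum_insert hl, hw, zero_smul, zero_add]

theorem shift_singleton {m l : Fin (k + 1)} {w : F}
    (hw : s.coordLin l (Φ.symbol w) = 0) : Φ.shift m {l} w = w := by
  rw [shift_apply, Finset.sum_singleton, hw, zero_smul, sub_zero]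

theorem symbol_ofFiber {x : s.Pt} (hx : x ∈ W) (a : A x) :
    Φ.symbol (Φ.ofFiber x a) = L.anchor x a := by
  rw [← Φ.anchor_toFiber x hx, Φ.toFiber_ofFiber x hx]

/-- The map from the model fibre to the fibres of the restriction to a face. -/
def toFace {m : Fin (k + 1)} {S : Finset (Fin (k + 1))} (hm : m ∉ S)
    (z : (Face.compl s hm).simplex.Pt) : F →ₗ[ℝ] L.faceFiber (Face.compl s hm) z :=
  LinearMap.codRestrict _ (Φ.toFiber ((Face.compl s hm).incl z) ∘ₗ Φ.shift m S) fun w => by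
    change L.anchor _ (Φ.toFiber _ (Φ.shift m S w)) ∈ (Face.compl s hm).tangent
    -- The zero value of `toFiber` outside `W` makes the map available at every point of the face.
    by_cases hz : (Face.compl s hm).incl z ∈ W
    · rw [Φ.anchor_toFiber _ hz, symbol_shift]
      exact s.collapseLin_mem_tangent hm _
    · rw [Φ.toFiber_of_notMem _ hz, LinearMap.zero_apply, map_zero]
      exact Submodule.zero_mem _

theorem coe_toFace {m : Fin (k + 1)} {S : Finset (Fin (k + 1))} (hm : m ∉ S)
    (z : (Face.compl s hm).simplex.Pt) (w : F) :
    (Φ.toFace hm z w : A ((Face.compl s hm).incl z)) = Φ.toFiber _ (Φ.shift m S w) := rfl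

/-- The pullback of a form on a face along the collapse of the simplex to this face. -/
def pullback {m : Fin (k + 1)} {S : Finset (Fin (k + 1))} (hm : m ∉ S) {p : ℕ}
    (τ : FaceForm L (Face.compl s hm) p) (x : s.Pt) : A x [⋀^Fin p]→ₗ[ℝ] ℝ :=
  (τ.toFun (s.collapse hm x)).compLinearMap (Φ.toFace hm (s.collapse hm x) ∘ₗ Φ.ofFiber x)

theorem pullback_apply {m : Fin (k + 1)} {S : Finset (Fin (k + 1))} (hm : m ∉ S) {p : ℕ}
    (τ : FaceForm L (Face.compl s hm) p) (x : s.Pt) (a : Fin p → A x) :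
    Φ.pullback hm τ x a = τ.toFun (s.collapse hm x)
      (fun i => Φ.toFace hm (s.collapse hm x) (Φ.ofFiber x (a i))) := rfl

/-- The fibres at `z` and `z'` are different types; vectors in them are compared through common
representatives in `F`. -/
theorem toFun_congr {α : Face s} {p : ℕ} (τ : FaceForm L α p) {z z' : α.simplex.Pt} (h : z = z')
    {u : Fin p → L.faceFiber α z} {u' : Fin p → L.faceFiber α z'} (w : Fin p → F)
    (hu : ∀ i, (u i : A (α.incl z)) = Φ.toFiber _ (w i))
    (hu' : ∀ i, (u' i : A (α.incl z')) = Φ.toFiber _ (w i)) : τ.toFun z u = τ.toFun z' u' := by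
  subst h
  congr 1
  funext i
  exact Subtype.ext ((hu i).trans (hu' i).symm)

/-- Where the `l`-coordinate vanishes on the point and on the anchors, moving `l` in addition to `S`
changes neither the image point nor the image vectors. Both pullbacks then evaluate `τ` on the same
data. This gives the cancellation in the alternating sum. -/
theorem pullback_insert {m l : Fin (k + 1)} {S : Finset (Fin (k + 1))} (hm : m ∉ S)
    (hm' : m ∉ insert l S) (hl : l ∉ S) {p : ℕ} (τ : FaceForm L (Face.compl s hm) p)
    (τ' : FaceForm L (Face.compl s hm') p)
    (h : τ.RestrictsTo (Face.compl_le_compl hm hm' (Finset.subset_insert l S)) τ')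
    {x : s.Pt} (hx : s.coordPt l x = 0) {a : Fin p → A x}
    (ha : ∀ i, s.coordLin l (Φ.symbol (Φ.ofFiber x (a i))) = 0) :
    Φ.pullback hm' τ' x a = Φ.pullback hm τ x a := by
  rw [pullback_apply, pullback_apply, ← h]
  refine Φ.toFun_congr τ (Subtype.ext ?_) (fun i => Φ.shift m S (Φ.ofFiber x (a i)))
    (fun i => ?_) fun i => rfl
  · exact congrArg (Subtype.val : s.Pt → E) (s.incl_collapse_insert hm hm' hl hx)
  · rw [← Φ.shift_insert hl (ha i)]
    rfl

/-- Collapsing `l` fixes `β` pointwise, and its lift fixes the vectors whose anchor is tangent to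
`β`. -/
theorem pullback_singleton {m l : Fin (k + 1)} (hm : m ∉ ({l} : Finset (Fin (k + 1))))
    {β : Face s} (hβ : β ≤ Face.compl s hm) (hl : l ∉ β.verts) {p : ℕ}
    (τ : FaceForm L (Face.compl s hm) p) (θ : FaceForm L β p) (h : τ.RestrictsTo hβ θ)
    {z : β.simplex.Pt} (hz : β.incl z ∈ W) (a : Fin p → L.faceFiber β z) :
    Φ.pullback hm τ (β.incl z) (fun i => (a i : A (β.incl z))) = θ.toFun z a := by
  rw [pullback_apply, ← h]
  refine Φ.toFun_congr τ (Subtype.ext ?_) (fun i => Φ.ofFiber (β.incl z) (a i)) (fun i => ?_)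
    fun i => (Φ.toFiber_ofFiber _ hz _).symm
  · exact congrArg (Subtype.val : s.Pt → E) (s.incl_collapse_eq_self hm (x := β.incl z) fun i hi => by
      rw [Finset.mem_singleton.1 hi]
      exact β.coordPt_incl_eq_zero hl z)
  · rw [coe_toFace, Φ.shift_singleton]
    rw [Φ.symbol_ofFiber hz]
    exact β.coordLin_eq_zero hl (a i).2

end FlatFrame

/-- Smoothness at the points of `W` of a form on the fibres of `A`, tested on sections over
faces. -/
def IsSmoothFormOn {p : ℕ} (θ : ∀ x : s.Pt, A x [⋀^Fin p]→ₗ[ℝ] ℝ) (W : Set s.Pt) : Prop :=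
  ∀ (α : Face s) (y : α.simplex.Pt), α.incl y ∈ W →
    ∀ σ : Fin p → ∀ z : α.simplex.Pt, A (α.incl z),
    (∀ i, ContMDiffAt α.simplex.model (s.model.prod 𝓘(ℝ, F)) ∞
      (fun z => (⟨α.incl z, σ i z⟩ : TotalSpace F A)) y) →
    ContMDiffAt α.simplex.model 𝓘(ℝ, ℝ) ∞ (fun z => θ (α.incl z) (fun i => σ i z)) y

/-- Expanding the arguments in a basis of `F` leaves coefficients, smooth since the sections are,
times values of `τ` on fixed smooth sections over the face. The frame is used at the point and at
its image, so both must lie in `W`. -/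
theorem FlatFrame.isSmoothFormOn_pullback [FiniteDimensional ℝ F] {L : LieAlgebroid s.model F A}
    {W : Set s.Pt} (Φ : FlatFrame L W) (hW : IsOpen W) {m : Fin (k + 1)}
    {S : Finset (Fin (k + 1))} (hm : m ∉ S) {p : ℕ} (τ : FaceForm L (Face.compl s hm) p) :
    IsSmoothFormOn (F := F) (Φ.pullback hm τ)
      {x | x ∈ W ∧ (Face.compl s hm).incl (s.collapse hm x) ∈ W} := by
  rintro α y ⟨hy, hy'⟩ σ hσ
  let b := Module.finBasis ℝ F
  let q : α.simplex.Pt → (Face.compl s hm).simplex.Pt := fun z => s.collapse hm (α.incl z)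
  have hq : ContMDiff α.simplex.model (Face.compl s hm).simplex.model ∞ q :=
    (s.contMDiff_collapse hm).comp α.contMDiff_incl
  have hc : ∀ i j, ContMDiffAt α.simplex.model 𝓘(ℝ, ℝ) ∞
      (fun z => b.repr (Φ.ofFiber (α.incl z) (σ i z)) j) y := by
    intro i j
    have h1 : ContMDiffAt (s.model.prod 𝓘(ℝ, F)) 𝓘(ℝ, F) ∞
        (fun a : TotalSpace F A => Φ.ofFiber a.1 a.2) ⟨α.incl y, σ i y⟩ :=
      Φ.smooth_ofFiber.contMDiffAt
        ((hW.preimage (FiberBundle.continuous_proj F A)).mem_nhds hy)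
    exact (LinearMap.toContinuousLinearMap (b.coord j)).contMDiff.contMDiffAt.comp y
      (h1.comp y (hσ i))
  have hτ : ∀ r : Fin p → Fin (Module.finrank ℝ F), ContMDiffAt α.simplex.model 𝓘(ℝ, ℝ) ∞
      (fun z => τ.toFun (q z) (fun i => Φ.toFace hm (q z) (b (r i)))) y := by
    intro r
    have hU : IsOpen ((Face.compl s hm).incl ⁻¹' W) :=
      hW.preimage (Face.compl s hm).contMDiff_incl.continuous
    have h1 := τ.smooth _ hU (fun i z => Φ.toFace hm z (b (r i))) fun i =>
      (Φ.smooth_toFiber (Φ.shift m S (b (r i)))).comp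
        (Face.compl s hm).contMDiff_incl.contMDiffOn fun _ h => h
    exact (h1.contMDiffAt (x := q y) (hU.mem_nhds hy')).comp y hq.contMDiffAt
  have heq : (fun z => Φ.pullback hm τ (α.incl z) (fun i => σ i z)) = fun z =>
      ∑ r : Fin p → Fin (Module.finrank ℝ F),
        (∏ i, b.repr (Φ.ofFiber (α.incl z) (σ i z)) (r i)) *
          τ.toFun (q z) (fun i => Φ.toFace hm (q z) (b (r i))) := by
    funext z
    have h1 : ∀ i, Φ.toFace hm (q z) (Φ.ofFiber (α.incl z) (σ i z)) =
        ∑ j, b.repr (Φ.ofFiber (α.incl z) (σ i z)) j • Φ.toFace hm (q z) (b j) := by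
      intro i
      simp only [← map_smul, ← map_sum, b.sum_repr]
    rw [FlatFrame.pullback_apply]
    change (τ.toFun (q z)).toMultilinearMap
      (fun i => Φ.toFace hm (q z) (Φ.ofFiber (α.incl z) (σ i z))) = _
    simp only [h1]
    rw [MultilinearMap.map_sum]
    refine Finset.sum_congr rfl fun r _ => ?_
    rw [MultilinearMap.map_smul_univ]
    rfl
  rw [heq]
  refine contMDiffAt_finsetSum fun r _ => ContMDiffAt.mul ?_ (hτ r)
  exact contMDiffAt_finsetProd fun i _ => hc i (r i)

end LieAlgebroid

namespace LieAlgebroid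

open Affine.Simplex
open scoped Topology

variable {E : Type*} [NormedAddCommGroup E] [NormedSpace ℝ E] {k : ℕ}
  {s : Affine.Simplex ℝ E k}
  {F : Type*} [NormedAddCommGroup F] [NormedSpace ℝ F]
  {A : s.Pt → Type*} [TopologicalSpace (TotalSpace F A)]
  [∀ x, AddCommGroup (A x)] [∀ x, Module ℝ (A x)] [∀ x, TopologicalSpace (A x)]
  [FiberBundle F A]

/-! ### Local extension of piecewise smooth forms -/

theorem _root_.AlternatingMap.finsetSum_apply {R M N ι κ : Type*} [Semiring R] [AddCommMonoid M]
    [Module R M] [AddCommMonoid N] [Module R N] (t : Finset κ) (f : κ → M [⋀^ι]→ₗ[R] N)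
    (v : ι → M) : (∑ i ∈ t, f i) v = ∑ i ∈ t, f i v :=
  map_sum ({ toFun := fun g => g v, map_zero' := rfl, map_add' := fun _ _ => rfl } :
    (M [⋀^ι]→ₗ[R] N) →+ N) f t

theorem IsSmoothFormOn.mono {p : ℕ} {θ : ∀ x : s.Pt, A x [⋀^Fin p]→ₗ[ℝ] ℝ} {W W' : Set s.Pt}
    (h : IsSmoothFormOn (F := F) θ W) (hW : W' ⊆ W) : IsSmoothFormOn (F := F) θ W' :=
  fun α y hy => h α y (hW hy)

theorem IsSmoothFormOn.zero {p : ℕ} (W : Set s.Pt) :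
    IsSmoothFormOn (F := F) (fun x => (0 : A x [⋀^Fin p]→ₗ[ℝ] ℝ)) W :=
  fun _ _ _ _ _ => contMDiffAt_const

theorem IsSmoothFormOn.const_smul {p : ℕ} {θ : ∀ x : s.Pt, A x [⋀^Fin p]→ₗ[ℝ] ℝ}
    {W : Set s.Pt} (h : IsSmoothFormOn (F := F) θ W) (c : ℝ) :
    IsSmoothFormOn (F := F) (fun x => c • θ x) W :=
  fun α y hy σ hσ => contMDiffAt_const.mul (h α y hy σ hσ)

theorem IsSmoothFormOn.sum {p : ℕ} {ι : Type*} {t : Finset ι}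
    {θ : ι → ∀ x : s.Pt, A x [⋀^Fin p]→ₗ[ℝ] ℝ} {W : Set s.Pt}
    (h : ∀ i ∈ t, IsSmoothFormOn (F := F) (θ i) W) :
    IsSmoothFormOn (F := F) (fun x => ∑ i ∈ t, θ i x) W := by
  intro α y hy σ hσ
  have := contMDiffAt_finsetSum (t := t) fun i hi => h i hi α y hy σ hσ
  refine this.congr_of_eventuallyEq (Filter.Eventually.of_forall fun z => ?_)
  exact AlternatingMap.finsetSum_apply _ _ _

variable [VectorBundle ℝ F A]

/-- The form `θ` extends the piecewise smooth form `ξ` at the points of `W`. -/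
def ExtendsOn {L : LieAlgebroid s.model F A} {p : ℕ} (ξ : PiecewiseForm L s.bdFaces p)
    (θ : ∀ x : s.Pt, A x [⋀^Fin p]→ₗ[ℝ] ℝ) (W : Set s.Pt) : Prop :=
  ∀ (β : Face s) (hβ : β ∈ s.bdFaces) (z : β.simplex.Pt), β.incl z ∈ W →
    ∀ a : Fin p → L.faceFiber β z,
      θ (β.incl z) (fun i => (a i : A (β.incl z))) = (ξ.form β hβ).toFun z a

/-- The contribution of a set `S` of vertices to the local extension: up to sign, the pullback of
the form on the opposite face along the collapse to this face. -/
def FlatFrame.extensionTerm {L : LieAlgebroid s.model F A} {W : Set s.Pt} (Φ : FlatFrame L W)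
    {p : ℕ} (ξ : PiecewiseForm L s.bdFaces p) (m : Fin (k + 1)) (S : Finset (Fin (k + 1)))
    (x : s.Pt) : A x [⋀^Fin p]→ₗ[ℝ] ℝ :=
  -- The sign is positive for singletons. The empty set gets zero: its opposite face is the whole
  -- simplex, where `ξ` gives no form.
  if h : m ∉ S ∧ S.Nonempty then
    (-1 : ℝ) ^ (S.card + 1) • Φ.pullback h.1 (ξ.form _ (Face.compl_mem_bdFaces h.1 h.2)) x
  else 0

theorem FlatFrame.isSmoothFormOn_extensionTerm [FiniteDimensional ℝ F]
    {L : LieAlgebroid s.model F A} {W : Set s.Pt} (Φ : FlatFrame L W) (hW : IsOpen W) {p : ℕ}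
    (ξ : PiecewiseForm L s.bdFaces p) (m : Fin (k + 1)) (S : Finset (Fin (k + 1))) :
    IsSmoothFormOn (F := F) (Φ.extensionTerm ξ m S)
      {x | x ∈ W ∧ ∀ hm : m ∉ S, (Face.compl s hm).incl (s.collapse hm x) ∈ W} := by
  by_cases h : m ∉ S ∧ S.Nonempty
  · have heq : Φ.extensionTerm ξ m S = fun x => (-1 : ℝ) ^ (S.card + 1) •
        Φ.pullback h.1 (ξ.form _ (Face.compl_mem_bdFaces h.1 h.2)) x := by
      funext x
      rw [extensionTerm, dif_pos h]
    rw [heq]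
    exact ((Φ.isSmoothFormOn_pullback hW h.1 _).const_smul _).mono fun x hx => ⟨hx.1, hx.2 h.1⟩
  · have heq : Φ.extensionTerm ξ m S = fun x => 0 := by
      funext x
      rw [extensionTerm, dif_neg h]
    rw [heq]
    exact IsSmoothFormOn.zero _

theorem exists_local_extension [FiniteDimensional ℝ F] [ContMDiffVectorBundle ∞ F A s.model]
    (L : LieAlgebroid s.model F A) (hL : L.IsTransitive) {p : ℕ}
    (ξ : PiecewiseForm L s.bdFaces p) (x₀ : s.Pt) :
    ∃ (W : Set s.Pt) (θ : ∀ x : s.Pt, A x [⋀^Fin p]→ₗ[ℝ] ℝ), IsOpen W ∧ x₀ ∈ W ∧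
      IsSmoothFormOn (F := F) θ W ∧ ExtendsOn ξ θ W := by
  classical
  obtain ⟨W, hW, hxW, ⟨Φ⟩⟩ := exists_flatFrame L hL x₀
  obtain ⟨m, hm⟩ := s.exists_coordPt_ne_zero x₀
  let J : Finset (Fin (k + 1)) := Finset.univ.filter fun i => s.coordPt i x₀ = 0
  have hJ : ∀ i, i ∈ J ↔ s.coordPt i x₀ = 0 := fun i => by simp [J]
  have hmJ : m ∉ J := fun h => hm ((hJ m).1 h)
  -- Near `x₀`, a boundary face can only miss vertices of `J`.
  have h1 : ∀ᶠ x in 𝓝 x₀, ∀ i, i ∉ J → s.coordPt i x ≠ 0 := by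
    rw [Filter.eventually_all]
    intro i
    by_cases hi : i ∈ J
    · exact Filter.Eventually.of_forall fun x h => absurd hi h
    · filter_upwards [(s.continuous_coordPt i).continuousAt.eventually_ne
        (fun h => hi ((hJ i).2 h))] with x hx _ using hx
  -- Collapsing a subset of `J` fixes `x₀`, so it keeps nearby points inside the domain of the
  -- frame.
  have h2 : ∀ᶠ x in 𝓝 x₀, ∀ S, S ∈ J.powerset → ∀ hm : m ∉ S,
      (Face.compl s hm).incl (s.collapse hm x) ∈ W := by
    rw [Filter.eventually_all]
    intro S
    by_cases hS : S ∈ J.powerset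
    · have hmS : m ∉ S := fun h => hmJ (Finset.mem_powerset.1 hS h)
      have hc : Continuous fun x => (Face.compl s hmS).incl (s.collapse hmS x) :=
        (Face.compl s hmS).contMDiff_incl.continuous.comp (s.contMDiff_collapse hmS).continuous
      have hx : (Face.compl s hmS).incl (s.collapse hmS x₀) = x₀ :=
        s.incl_collapse_eq_self hmS fun i hi => (hJ i).1 (Finset.mem_powerset.1 hS hi)
      have : ∀ᶠ x in 𝓝 x₀, (Face.compl s hmS).incl (s.collapse hmS x) ∈ W :=
        hc.continuousAt.eventually (hW.mem_nhds (by simpa only [hx] using hxW))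
      filter_upwards [this] with x hx _ _ using hx
    · exact Filter.Eventually.of_forall fun x h => absurd h hS
  obtain ⟨W', hW', hW'o, hxW'⟩ := eventually_nhds_iff.1 (h1.and (h2.and (hW.mem_nhds hxW)))
  refine ⟨W', fun x => ∑ S ∈ J.powerset, Φ.extensionTerm ξ m S x, hW'o, hxW',
    IsSmoothFormOn.sum fun S hS => (Φ.isSmoothFormOn_extensionTerm hW ξ m S).mono
      fun x hx => ⟨(hW' x hx).2.2, (hW' x hx).2.1 S hS⟩, ?_⟩
  intro β hβ z hz a
  have hzW : β.incl z ∈ W := (hW' _ hz).2.2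
  obtain ⟨l, hl⟩ : ∃ l, l ∉ β.verts := by
    by_contra! h
    exact hβ (Finset.eq_univ_iff_forall.2 h)
  have hl0 : s.coordPt l (β.incl z) = 0 := β.coordPt_incl_eq_zero hl z
  have hlJ : l ∈ J := by
    by_contra h
    exact (hW' _ hz).1 l h hl0
  have hml : m ≠ l := fun h => hmJ (h ▸ hlJ)
  have ha : ∀ i, s.coordLin l (Φ.symbol (Φ.ofFiber (β.incl z) (a i))) = 0 := fun i => by
    rw [Φ.symbol_ofFiber hzW]
    exact β.coordLin_eq_zero hl (a i).2
  -- Pair each `S` not containing `l` with `insert l S`; only the pair of `∅` and `{l}` survives.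
  rw [AlternatingMap.finsetSum_apply, ← Finset.insert_erase hlJ,
    Finset.sum_powerset_insert (Finset.notMem_erase l J), ← Finset.sum_add_distrib,
    Finset.sum_eq_single ∅]
  · have hm1 : m ∉ ({l} : Finset (Fin (k + 1))) := by simpa using hml
    have hle : β ≤ Face.compl s hm1 := fun i hi => by
      simpa [Face.compl] using ne_of_mem_of_not_mem hi hl
    have e1 : Φ.extensionTerm ξ m ∅ (β.incl z) = 0 := dif_neg (by simp)
    have e2 : Φ.extensionTerm ξ m (insert l ∅) (β.incl z) =
        (-1 : ℝ) ^ (1 + 1) • Φ.pullback hm1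
          (ξ.form _ (Face.compl_mem_bdFaces hm1 (Finset.singleton_nonempty l))) (β.incl z) :=
      dif_pos (⟨hm1, Finset.singleton_nonempty l⟩ : m ∉ ({l} : Finset _) ∧ _)
    rw [e1, e2, AlternatingMap.zero_apply, zero_add, AlternatingMap.smul_apply,
      Φ.pullback_singleton hm1 hle hl _ (ξ.form β hβ) (ξ.compatible _ _ _ _ _) hzW a]
    simp
  · intro S hS hS0
    -- The two pullbacks agree on `β` and carry opposite signs.
    have hlS : l ∉ S := fun h => Finset.notMem_erase l J (Finset.mem_powerset.1 hS h)
    have hmS : m ∉ S := fun h => hmJ (Finset.mem_of_mem_erase (Finset.mem_powerset.1 hS h))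
    have hmS' : m ∉ insert l S := by simp [hml, hmS]
    have hSn := Finset.nonempty_iff_ne_empty.2 hS0
    rw [FlatFrame.extensionTerm, FlatFrame.extensionTerm, dif_pos ⟨hmS, hSn⟩,
      dif_pos ⟨hmS', Finset.insert_nonempty l S⟩, AlternatingMap.smul_apply,
      AlternatingMap.smul_apply, Φ.pullback_insert hmS hmS' hlS _ _
        (ξ.compatible _ (Face.compl_mem_bdFaces hmS hSn) _
          (Face.compl_mem_bdFaces hmS' (Finset.insert_nonempty l S)) _) hl0 ha,
      Finset.card_insert_of_notMem hlS, pow_succ (-1 : ℝ) (S.card + 1)]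
    simp
  · intro h
    exact absurd (Finset.empty_mem_powerset _) h

/-! ### Gluing local extensions -/

/-- A form on the fibres of `A`, smooth along the face `α`, restricts to a form on this face. -/
def FaceForm.ofIsSmoothFormOn (L : LieAlgebroid s.model F A) {p : ℕ}
    (θ : ∀ x : s.Pt, A x [⋀^Fin p]→ₗ[ℝ] ℝ) (h : IsSmoothFormOn (F := F) θ Set.univ) (α : Face s) :
    FaceForm L α p where
  toFun x := (θ (α.incl x)).compLinearMap (L.faceFiber α x).subtype
  smooth _ hU σ hσ y hy := (h α y (Set.mem_univ _) (fun i x => σ i x) fun i =>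
    (hσ i).contMDiffAt (hU.mem_nhds hy)).contMDiffWithinAt

/-- The equality of points is kept abstract so that `subst` removes it; it is applied to the two
ways of including a face of a face. -/
theorem compLinearMap_subtype_of_eq {V : s.Pt → Type*} [∀ x, AddCommGroup (V x)]
    [∀ x, Module ℝ (V x)] {p : ℕ} (θ : ∀ x : s.Pt, V x [⋀^Fin p]→ₗ[ℝ] ℝ) {x y : s.Pt}
    (h : y = x) {P : Submodule ℝ (V x)} {Q : Submodule ℝ (V y)} (f : P →ₗ[ℝ] Q)
    (hf : ∀ a : P, HEq (f a : V y) (a : V x)) :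
    ((θ y).compLinearMap Q.subtype).compLinearMap f = (θ x).compLinearMap P.subtype := by
  subst h
  ext a
  exact congrArg (θ y) (funext fun i => eq_of_heq (hf (a i)))

theorem coe_faceFiberIncl_heq (L : LieAlgebroid s.model F A) {β α : Face s} (h : β ≤ α)
    (x : β.simplex.Pt) (a : L.faceFiber β x) :
    HEq (L.faceFiberIncl h x a : A (α.incl (Face.inclOfLE h x))) (a : A (β.incl x)) := by
  -- a bare `HEq.rfl` is very slow to check in the kernel
  have h1 : L.faceFiberIncl h x a = ⟨(a : A (β.incl x)), L.faceFiber_le h x a.2⟩ := rfl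
  rw [h1]
  exact heq_of_eq (Submodule.coe_mk _ (L.faceFiber_le h x a.2))

theorem FaceForm.ofIsSmoothFormOn_restrictsTo (L : LieAlgebroid s.model F A) {p : ℕ}
    (θ : ∀ x : s.Pt, A x [⋀^Fin p]→ₗ[ℝ] ℝ) (h : IsSmoothFormOn (F := F) θ Set.univ)
    {α β : Face s} (hβ : β ≤ α) :
    (FaceForm.ofIsSmoothFormOn L θ h α).RestrictsTo hβ (FaceForm.ofIsSmoothFormOn L θ h β) :=
  fun x => compLinearMap_subtype_of_eq θ (x := β.incl x) rfl (L.faceFiberIncl hβ x)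
    (coe_faceFiberIncl_heq L hβ x)

/-- The weights of a partition of unity sum to one, so the glued form still takes the prescribed
values on the boundary. -/
theorem exists_extension [FiniteDimensional ℝ F] [ContMDiffVectorBundle ∞ F A s.model]
    (L : LieAlgebroid s.model F A) (hL : L.IsTransitive) {p : ℕ}
    (ξ : PiecewiseForm L s.bdFaces p) :
    ∃ θ : ∀ x : s.Pt, A x [⋀^Fin p]→ₗ[ℝ] ℝ,
      IsSmoothFormOn (F := F) θ Set.univ ∧ ExtendsOn ξ θ Set.univ := by
  choose W θ hWo hxW hθ hξ using exists_local_extension L hL ξ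
  have : CompactSpace s.Pt := isCompact_iff_compactSpace.1 s.isCompact_closedInterior
  obtain ⟨ρ, hρ⟩ := SmoothPartitionOfUnity.exists_isSubordinate s.model isClosed_univ W hWo
    fun x _ => Set.mem_iUnion.2 ⟨x, hxW x⟩
  have happly : ∀ x (a : Fin p → A x), (∑ c ∈ ρ.finsupport x, ρ c x • θ c x) a =
      ∑ c ∈ ρ.finsupport x, ρ c x • θ c x a := fun x a => by
    rw [AlternatingMap.finsetSum_apply]
    rfl
  refine ⟨fun x => ∑ c ∈ ρ.finsupport x, ρ c x • θ c x, ?_, ?_⟩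
  · intro α y _ σ hσ
    -- The index set `ρ.finsupport` varies with the point; a locally finite `finsum` over fixed
    -- indices can be tested for smoothness.
    have heq : (fun z => (∑ c ∈ ρ.finsupport (α.incl z), ρ c (α.incl z) • θ c (α.incl z))
        (fun i => σ i z)) =
        fun z => ∑ᶠ c, ρ c (α.incl z) • θ c (α.incl z) (fun i => σ i z) := by
      funext z
      rw [happly, finsum_eq_sum_of_support_subset]
      intro c hc
      rw [ρ.coe_finsupport]
      intro h0
      exact hc (by simp only [h0, zero_smul])
    rw [heq]
    have hincl := α.contMDiff_incl
    refine contMDiffAt_finsum ?_ fun c => ?_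
    · have := ρ.locallyFinite.preimage_continuous hincl.continuous
      refine this.subset fun c z hz h0 => hz ?_
      simp only [h0, zero_smul]
    -- On the closed support of `ρ c` the local form is smooth by subordination; off it the summand
    -- vanishes nearby.
    · by_cases hc : α.incl y ∈ tsupport (ρ c)
      · exact (((ρ c).contMDiff.comp hincl).contMDiffAt).smul (hθ c α y (hρ c hc) σ hσ)
      · have h0 : ∀ᶠ z in 𝓝 y, ρ c (α.incl z) = 0 :=
          hincl.continuous.continuousAt.eventually (notMem_tsupport_iff_eventuallyEq.1 hc)
        refine contMDiffAt_const (c := (0 : ℝ)) |>.congr_of_eventuallyEq ?_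
        filter_upwards [h0] with z hz
        rw [hz, zero_smul]
  · intro β hβ z _ a
    rw [happly, Finset.sum_congr rfl (g := fun c => ρ c (β.incl z) • (ξ.form β hβ).toFun z a),
      ← Finset.sum_smul, ρ.sum_finsupport _ (Set.mem_univ _), one_smul]
    intro c hc
    rw [hξ c β hβ z (hρ c (subset_tsupport _ ((ρ.mem_finsupport _).1 hc))) a]

/-- The piecewise smooth form on all faces given by a smooth form on the fibres of `A` extending a
piecewise smooth form on the boundary. -/
theorem exists_piecewiseForm_extension [FiniteDimensional ℝ F]
    [ContMDiffVectorBundle ∞ F A s.model] (L : LieAlgebroid s.model F A) (hL : L.IsTransitive)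
    {p : ℕ} (ξ : PiecewiseForm L s.bdFaces p) :
    ∃ η : PiecewiseForm L s.allFaces p, η.restrict (Set.subset_univ s.bdFaces) = ξ := by
  obtain ⟨θ, hθ, hξ⟩ := exists_extension L hL ξ
  refine ⟨⟨fun α _ => FaceForm.ofIsSmoothFormOn L θ hθ α, fun α _ β _ h =>
    FaceForm.ofIsSmoothFormOn_restrictsTo L θ hθ h⟩, ?_⟩
  ext β hβ z a
  exact hξ β hβ z (Set.mem_univ _) a

end LieAlgebroid

end

theorem proposition3p2 {E : Type*} [NormedAddCommGroup E] [NormedSpace ℝ E] {k : ℕ}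
    (Δ : Affine.Simplex ℝ E k)
    {F : Type*} [NormedAddCommGroup F] [NormedSpace ℝ F] [FiniteDimensional ℝ F]
    {A : Δ.Pt → Type*} [TopologicalSpace (Bundle.TotalSpace F A)]
    [∀ x, AddCommGroup (A x)] [∀ x, Module ℝ (A x)] [∀ x, TopologicalSpace (A x)]
    [FiberBundle F A] [VectorBundle ℝ F A] [ContMDiffVectorBundle ∞ F A Δ.model]
    (L : LieAlgebroid Δ.model F A) (hL : L.IsTransitive) (p : ℕ)
    (ξ : LieAlgebroid.PiecewiseForm L Δ.bdFaces p) :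
    ∃ η : LieAlgebroid.PiecewiseForm L Δ.allFaces p,
      η.restrict (Set.subset_univ Δ.bdFaces) = ξ :=
  LieAlgebroid.exists_piecewiseForm_extension L hL ξ
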